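/- Let $E$ be a finite-dimensional complex Hilbert space and let $\mathcal L(E)$ be the algebra of linear operators on $E$. Let $L^2(E)$ be the space of square integrable $E$-valued functions on the unit circle $\mathbb T$ (with normalized Lebesgue measure), and let $H^2(E)\subset L^2(E)$ be the subspace of functions whose negative Fourier coefficients vanish; $L^2(\mathcal L(E))$ and $H^2(\mathcal L(E))$ are defined in the same way. Let $\Theta\in H^2(\mathcal L(E))$ be a pure inner function, that is, $\Theta(e^{it})$ is unitary for almost every $t$ and $\|\Theta(0)\|<1$. Let $K_\Theta=H^2(E)\ominus\Theta H^2(E)$ be the associated model space, let $P_\Theta$ be the orthogonal projection of $L^2(E)$ onto $K_\Theta$, and let $(Sf)(z)=zf(z)$ be the forward shift on $H^2(E)$. A bounded operator $A$ on $K_\Theta$ is called a matrix-valued truncated Toeplitz operator if there is $\Phi\in L^2(\mathcal L(E))$ such that $Af=P_\Theta(\Phi f)$ for every essentially bounded $f\in K_\Theta$. It is called shift invariant if $\langle ASf,Sf\rangle=\langle Af,f\rangle$ for every $f\in K_\Theta$ such that $Sf\in K_\Theta$. Theorem. A bounded operator $A$ on $K_\Theta$ is a matrix-valued truncated Toeplitz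 operator if and only if $A$ is shift invariant. -/

import Mathlib

open MeasureTheory
open scoped ENNReal

namespace MTTO

instance factTwoPiPos : Fact (0 < 2 * Real.pi) := ⟨Real.two_pi_pos⟩

/-- The unit circle, parametrised by `t ↦ e^{it}` with `t` real modulo `2π`. -/
abbrev T : Type := AddCircle (2 * Real.pi)

/-- Normalised Lebesgue measure `dt / 2π` on the unit circle. -/
noncomputable abbrev mu : Measure T := AddCircle.haarAddCircle

variable {E : Type*} [NormedAddCommGroup E] [InnerProductSpace ℂ E]

/-- The Hilbert space `L²(E)` of square integrable `E`-valued functions on the circle. -/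
abbrev L2 (E : Type*) [NormedAddCommGroup E] [InnerProductSpace ℂ E] : Type _ := Lp E 2 mu

/-- The `n`-th Fourier coefficient as a bounded linear map on `L²(E)`. -/
noncomputable def coeffL (E : Type*) [NormedAddCommGroup E] [InnerProductSpace ℂ E] (n : ℤ) :
    L2 E →L[ℂ] E :=
  LinearMap.mkContinuous
    { toFun := fun f => fourierCoeff (⇑f) n
      map_add' := fun f g => by
        rw [fourierCoeff_congr_ae (Lp.coeFn_add f g),
          fourierCoeff.add ((Lp.memLp f).integrable (by norm_num))
            ((Lp.memLp g).integrable (by norm_num))]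
        rfl
      map_smul' := fun c f => by
        rw [fourierCoeff_congr_ae (Lp.coeFn_smul c f), fourierCoeff.const_smul]
        rfl } 1 (fun f => by
    have h1 : ‖fourierCoeff (⇑f) n‖ₑ ≤ ‖f‖ₑ := by
      calc ‖fourierCoeff (⇑f) n‖ₑ
          ≤ ∫⁻ t, ‖(fourier (-n) t : ℂ) • f t‖ₑ ∂mu := enorm_integral_le_lintegral_enorm _
        _ = ∫⁻ t, ‖f t‖ₑ ∂mu := by
            refine lintegral_congr fun t => ?_
            rw [enorm_smul]
            have : ‖(fourier (-n) t : ℂ)‖ₑ = 1 := by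
              rw [← ofReal_norm, fourier_apply, Circle.norm_coe]; simp
            rw [this, one_mul]
        _ = eLpNorm f 1 mu := (eLpNorm_one_eq_lintegral_enorm).symm
        _ ≤ eLpNorm f 2 mu :=
            eLpNorm_le_eLpNorm_of_exponent_le (by norm_num) (Lp.aestronglyMeasurable f)
        _ = ‖f‖ₑ := (Lp.enorm_def f).symm
    have h2 := (enorm_le_iff_norm_le).1 h1
    simpa using h2)

theorem coeffL_apply (n : ℤ) (f : L2 E) : coeffL E n f = fourierCoeff (⇑f) n := rfl

/-- The Hardy space `H²(E)`: functions in `L²(E)` whose negative Fourier coefficients vanish. -/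
noncomputable def H2 (E : Type*) [NormedAddCommGroup E] [InnerProductSpace ℂ E] :
    Submodule ℂ (L2 E) :=
  ⨅ n : {n : ℤ // n < 0}, LinearMap.ker (coeffL E n.1).toLinearMap

theorem mem_H2 {f : L2 E} : f ∈ H2 E ↔ ∀ n : ℤ, n < 0 → fourierCoeff (⇑f) n = 0 := by
  simp [H2, Submodule.mem_iInf, coeffL_apply]

theorem isClosed_H2 : IsClosed (H2 E : Set (L2 E)) := by
  have h : (H2 E : Set (L2 E)) = ⋂ n : {n : ℤ // n < 0}, (coeffL E n.1) ⁻¹' {0} := by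
    ext f
    simp [mem_H2, coeffL_apply]
  rw [h]
  exact isClosed_iInter fun n => isClosed_singleton.preimage (coeffL E n.1).continuous

/-- The value at `z` in the unit disc of the analytic function `∑ zⁿ aₙ` whose boundary values
have Fourier coefficients `aₙ`. -/
noncomputable def diskValue {F : Type*} [NormedAddCommGroup F] [NormedSpace ℂ F]
    (f : T → F) (z : ℂ) : F :=
  ∑' n : ℕ, z ^ n • fourierCoeff f (n : ℤ)

theorem diskValue_zero {F : Type*} [NormedAddCommGroup F] [NormedSpace ℂ F] (f : T → F) :
    diskValue f 0 = fourierCoeff f 0 := by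
  rw [diskValue, tsum_eq_single 0]
  · simp
  · intro n hn
    simp [hn]

/-- An inner function, given by its boundary values: an element of `H²(𝓛(E))` that is
unitary at almost every point of the circle. -/
structure IsInner [FiniteDimensional ℂ E] (Θ : T → E →L[ℂ] E) : Prop where
  memLp : MemLp Θ 2 mu
  coeff_eq_zero : ∀ n : ℤ, n < 0 → fourierCoeff Θ n = 0
  unitary_ae : haveI : CompleteSpace E := FiniteDimensional.complete ℂ E
    ∀ᵐ t ∂mu, Θ t ∈ unitary (E →L[ℂ] E)

/-- `Θ` is pure if `‖Θ(0)‖ < 1`. -/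
def IsPure (Θ : T → E →L[ℂ] E) : Prop := ‖diskValue Θ 0‖ < 1

/-- The space `Θ H²(E)`, as a subspace of `L²(E)`. -/
noncomputable def thetaH2 (Θ : T → E →L[ℂ] E) : Submodule ℂ (L2 E) where
  carrier := {g | ∃ f ∈ H2 E, ⇑g =ᵐ[mu] fun t => Θ t (f t)}
  add_mem' := by
    rintro g₁ g₂ ⟨f₁, hf₁, h₁⟩ ⟨f₂, hf₂, h₂⟩
    refine ⟨f₁ + f₂, Submodule.add_mem _ hf₁ hf₂, ?_⟩
    filter_upwards [h₁, h₂, Lp.coeFn_add g₁ g₂, Lp.coeFn_add f₁ f₂] with t a b c d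
    rw [c, Pi.add_apply, a, b, d, Pi.add_apply, map_add]
  zero_mem' := by
    refine ⟨0, Submodule.zero_mem _, ?_⟩
    filter_upwards [Lp.coeFn_zero E 2 mu] with t a
    rw [a, Pi.zero_apply, map_zero]
  smul_mem' := by
    rintro c g ⟨f, hf, h⟩
    refine ⟨c • f, Submodule.smul_mem _ _ hf, ?_⟩
    filter_upwards [h, Lp.coeFn_smul c g, Lp.coeFn_smul c f] with t a b d
    rw [b, Pi.smul_apply, a, d, Pi.smul_apply, map_smul]

/-- The model space `K_Θ = H²(E) ⊖ Θ H²(E)`. -/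
noncomputable def modelSpace (Θ : T → E →L[ℂ] E) : Submodule ℂ (L2 E) :=
  H2 E ⊓ (thetaH2 Θ)ᗮ

instance hasOrthogonalProjection_modelSpace [FiniteDimensional ℂ E] (Θ : T → E →L[ℂ] E) :
    (modelSpace Θ).HasOrthogonalProjection := by
  have : CompleteSpace E := FiniteDimensional.complete ℂ E
  have h : IsClosed (modelSpace Θ : Set (L2 E)) :=
    isClosed_H2.inter (Submodule.isClosed_orthogonal (thetaH2 Θ))
  have : CompleteSpace (modelSpace Θ) := h.completeSpace_coe
  infer_instance

theorem memLp_mul {Φ : T → E →L[ℂ] E} {f : T → E} (hΦ : MemLp Φ 2 mu) (hf : MemLp f ∞ mu) :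
    MemLp (fun t => Φ t (f t)) 2 mu :=
  (ContinuousLinearMap.id ℂ (E →L[ℂ] E)).memLp_of_bilin 2 hΦ hf

/-- The product `Φ f ∈ L²(E)` of a symbol `Φ ∈ L²(𝓛(E))` and a bounded function `f`. -/
noncomputable def mulSymbol {Φ : T → E →L[ℂ] E} (hΦ : MemLp Φ 2 mu) {f : L2 E}
    (hf : MemLp f ∞ mu) : L2 E :=
  (memLp_mul hΦ hf).toLp (fun t => Φ t (f t))

/-- The bounded operator `A` on `K_Θ` is the matrix-valued truncated Toeplitz operator with
symbol `Φ`: it extends the map `f ↦ P_Θ (Φ f)`, defined on the bounded functions in `K_Θ`. -/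
def IsTruncatedToeplitzWithSymbol [FiniteDimensional ℂ E] {Θ Φ : T → E →L[ℂ] E}
    (hΦ : MemLp Φ 2 mu) (A : modelSpace Θ →L[ℂ] modelSpace Θ) : Prop :=
  ∀ (f : modelSpace Θ) (hf : MemLp (f : L2 E) ∞ mu),
    A f = (modelSpace Θ).orthogonalProjectionOnto (mulSymbol hΦ hf)

/-- The set of all matrix-valued truncated Toeplitz operators on `K_Θ`. -/
def truncatedToeplitz [FiniteDimensional ℂ E] (Θ : T → E →L[ℂ] E) :
    Set (modelSpace Θ →L[ℂ] modelSpace Θ) :=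
  {A | ∃ (Φ : T → E →L[ℂ] E) (hΦ : MemLp Φ 2 mu), IsTruncatedToeplitzWithSymbol hΦ A}

theorem memLp_shift (f : L2 E) : MemLp (fun t => (fourier 1 t : ℂ) • f t) 2 mu := by
  refine (Lp.memLp f).of_le
    ((map_continuous (fourier 1)).aestronglyMeasurable.smul (Lp.aestronglyMeasurable f))
    (ae_of_all _ fun t => ?_)
  rw [norm_smul, fourier_apply, Circle.norm_coe, one_mul]

/-- The forward shift `(S f)(z) = z f(z)`; here `fourier 1` is the function `z = e^{it}`. -/
noncomputable def shift (f : L2 E) : L2 E :=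
  (memLp_shift f).toLp (fun t => (fourier 1 t : ℂ) • f t)

/-- The quadratic form `Q_A(f) = ⟨A f, f⟩` (Mathlib's inner product is linear in its second
argument). -/
noncomputable def quadForm {Θ : T → E →L[ℂ] E} (A : modelSpace Θ →L[ℂ] modelSpace Θ)
    (f : modelSpace Θ) : ℂ :=
  inner ℂ f (A f)

/-- `A` is shift invariant: `Q_A(S f) = Q_A(f)` whenever `f` and `S f` both lie in `K_Θ`. -/
def IsShiftInvariant {Θ : T → E →L[ℂ] E} (A : modelSpace Θ →L[ℂ] modelSpace Θ) : Prop :=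
  ∀ (f : modelSpace Θ) (hf : shift (f : L2 E) ∈ modelSpace Θ),
    quadForm A f = quadForm A ⟨shift (f : L2 E), hf⟩

end MTTO

/-! Let `Z` be the backward shift on `K_Θ`. A function in `K_Θ` has the form `S g` with `g` in `K_Θ`
exactly when it vanishes at 0, and then `g` is its image under `Z`. So shift invariance says that
the quadratic form of `Q = A - Z* A Z` vanishes on the kernel of `f ↦ f(0)`
(`isShiftInvariant_iff`).

If `A` has symbol `Φ`, this holds for bounded `f` because multiplication by `z` is isometric and
commutes with `Φ`. It extends by continuity, since the bounded functions are dense in that kernel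
(`mem_closure_bounded_of_coeffL_zero`).

Conversely, polarization and the finite rank of `f ↦ f(0)` give `⟨g, Q f⟩ = ⟨g, B f(0)⟩ + ⟨B' g(0),
f⟩` (`exists_inner_map_eq_add`). Applying this to `Zⁿ f`, `Zⁿ g` and summing telescopes. As `Zᴺ → 0`
strongly, `⟨g, A f⟩` is the sum of `⟨g, zⁿ B fₙ⟩ + ⟨zⁿ B' gₙ, f⟩` over the Taylor coefficients
(`tendsto_sum_inner`). With `Ψ x = B x` and `Ψ' x = B' x`, the sum is `⟨g, (Ψ + Ψ'*) f⟩` for bounded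
`f`, `g`, which exhibits the symbol. -/

namespace MTTO

/-! ### Multiplication operators and Fourier series in `L²(E)` -/

section Multiplication

variable {E : Type*} [NormedAddCommGroup E] [InnerProductSpace ℂ E]

/-- `G` is a measurable field of isometries of `E`. -/
structure IsIsometryField (G : T → E →L[ℂ] E) : Prop where
  aestronglyMeasurable : AEStronglyMeasurable G mu
  norm_map_ae : ∀ᵐ t ∂mu, ∀ v, ‖G t v‖ = ‖v‖

theorem IsIsometryField.memLp {G : T → E →L[ℂ] E} (hG : IsIsometryField G) {p : ℝ≥0∞} {f : T → E}
    (hf : MemLp f p mu) : MemLp (fun t => G t (f t)) p mu := by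
  refine hf.of_le ((ContinuousLinearMap.id ℂ (E →L[ℂ] E)).aestronglyMeasurable_comp₂
    hG.aestronglyMeasurable hf.aestronglyMeasurable) ?_
  filter_upwards [hG.norm_map_ae] with t ht
  exact (ht _).le

/-- Multiplication by a field of isometries, as an isometry of `L²(E)`. -/
noncomputable def mulIsometry {G : T → E →L[ℂ] E} (hG : IsIsometryField G) : L2 E →ₗᵢ[ℂ] L2 E where
  toFun f := (hG.memLp (Lp.memLp f)).toLp _
  map_add' f g := by
    rw [← MemLp.toLp_add]
    refine MemLp.toLp_congr _ _ ?_
    filter_upwards [Lp.coeFn_add f g] with t h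
    rw [h, Pi.add_apply, Pi.add_apply, map_add]
  map_smul' c f := by
    rw [RingHom.id_apply, ← MemLp.toLp_const_smul]
    refine MemLp.toLp_congr _ _ ?_
    filter_upwards [Lp.coeFn_smul c f] with t h
    rw [h, Pi.smul_apply, Pi.smul_apply, map_smul]
  norm_map' f := by
    change ‖(hG.memLp (Lp.memLp f)).toLp _‖ = _
    rw [Lp.norm_toLp, Lp.norm_def]
    refine congrArg _ (eLpNorm_congr_norm_ae ?_)
    filter_upwards [hG.norm_map_ae] with t ht
    exact ht _

theorem coeFn_mulIsometry {G : T → E →L[ℂ] E} (hG : IsIsometryField G) (f : L2 E) :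
    mulIsometry hG f =ᵐ[mu] fun t => G t (f t) :=
  MemLp.coeFn_toLp (hG.memLp (Lp.memLp f))

theorem memLp_top_mulIsometry {G : T → E →L[ℂ] E} (hG : IsIsometryField G) {f : L2 E}
    (hf : MemLp f ∞ mu) : MemLp (mulIsometry hG f) ∞ mu :=
  (hG.memLp hf).ae_eq (coeFn_mulIsometry hG f).symm

theorem norm_fourier_apply (n : ℤ) (t : T) : ‖(fourier n t : ℂ)‖ = 1 := by
  rw [fourier_apply, Circle.norm_coe]

theorem isIsometryField_fourier (n : ℤ) :
    IsIsometryField (fun t : T => (fourier n t : ℂ) • ContinuousLinearMap.id ℂ E) where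
  aestronglyMeasurable :=
    ((map_continuous (fourier n)).smul continuous_const).aestronglyMeasurable
  norm_map_ae := ae_of_all _ fun t v => by
    rw [_root_.smul_apply, norm_smul, norm_fourier_apply, one_mul]; rfl

variable (E) in
/-- Multiplication by `zⁿ` on `L²(E)`. -/
noncomputable def mulChar (n : ℤ) : L2 E →ₗᵢ[ℂ] L2 E :=
  mulIsometry (isIsometryField_fourier n)

theorem coeFn_mulChar (n : ℤ) (f : L2 E) :
    mulChar E n f =ᵐ[mu] fun t => (fourier n t : ℂ) • f t :=
  coeFn_mulIsometry _ f

theorem shift_eq_mulChar (f : L2 E) : shift f = mulChar E 1 f := by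
  refine Lp.ext ((MemLp.coeFn_toLp _).trans (coeFn_mulChar 1 f).symm)

theorem mulChar_mulChar (m n : ℤ) (f : L2 E) :
    mulChar E m (mulChar E n f) = mulChar E (m + n) f := by
  refine Lp.ext ?_
  filter_upwards [coeFn_mulChar m (mulChar E n f), coeFn_mulChar n f, coeFn_mulChar (m + n) f]
    with t h₁ h₂ h₃
  rw [h₁, h₂, h₃, smul_smul, fourier_add]

theorem mulChar_zero (f : L2 E) : mulChar E 0 f = f := by
  refine Lp.ext ?_
  filter_upwards [coeFn_mulChar 0 f] with t h
  simp [h]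

theorem mulIsometry_mulChar {G : T → E →L[ℂ] E} (hG : IsIsometryField G) (n : ℤ) (f : L2 E) :
    mulIsometry hG (mulChar E n f) = mulChar E n (mulIsometry hG f) := by
  refine Lp.ext ?_
  filter_upwards [coeFn_mulIsometry hG (mulChar E n f), coeFn_mulChar n f,
    coeFn_mulChar n (mulIsometry hG f), coeFn_mulIsometry hG f] with t h₁ h₂ h₃ h₄
  rw [h₁, h₂, h₃, h₄, map_smul]

theorem inner_mulChar_left (n : ℤ) (f g : L2 E) :
    inner ℂ (mulChar E n f) g = inner ℂ f (mulChar E (-n) g) := by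
  conv_lhs => rw [← mulChar_zero g, ← add_neg_cancel n, ← mulChar_mulChar n (-n) g]
  exact (mulChar E n).inner_map_map _ _

theorem coeffL_mulChar (m n : ℤ) (f : L2 E) :
    coeffL E m (mulChar E n f) = coeffL E (m - n) f := by
  rw [coeffL_apply, coeffL_apply, fourierCoeff, fourierCoeff]
  refine integral_congr_ae ?_
  filter_upwards [coeFn_mulChar n f] with t h
  rw [h, smul_smul, ← fourier_add]
  congr 3
  ring

variable (E) in
/-- The monomials `zⁿ x`, as a bounded linear map of `x`. -/
noncomputable def mono (n : ℤ) : E →L[ℂ] L2 E :=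
  (mulChar E n).toContinuousLinearMap ∘L Lp.constL 2 mu ℂ

theorem coeFn_mono (n : ℤ) (x : E) : mono E n x =ᵐ[mu] fun t => (fourier n t : ℂ) • x := by
  filter_upwards [coeFn_mulChar n (Lp.constL 2 mu ℂ x), Lp.coeFn_const 2 mu x] with t h₁ h₂
  refine h₁.trans ?_
  exact congrArg _ h₂

theorem mulChar_mono (m n : ℤ) (x : E) : mulChar E m (mono E n x) = mono E (m + n) x :=
  mulChar_mulChar m n _

theorem memLp_top_mono (n : ℤ) (x : E) : MemLp (mono E n x) ∞ mu := by
  refine memLp_top_of_bound (Lp.aestronglyMeasurable _) ‖x‖ ?_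
  filter_upwards [coeFn_mono n x] with t h
  rw [h, norm_smul, norm_fourier_apply, one_mul]

theorem inner_mono_left [CompleteSpace E] (n : ℤ) (x : E) (f : L2 E) :
    inner ℂ (mono E n x) f = inner ℂ x (coeffL E n f) := by
  have h : Integrable (fun t => (fourier (-n) t : ℂ) • f t) mu :=
    (((isIsometryField_fourier (-n)).memLp (Lp.memLp f)).integrable (by norm_num)).congr
      (ae_of_all _ fun t => by simp)
  rw [L2.inner_def, coeffL_apply, fourierCoeff, ← integral_inner h]
  refine integral_congr_ae ?_
  filter_upwards [coeFn_mono n x] with t ht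
  rw [ht, inner_smul_left, inner_smul_right, fourier_neg]

theorem inner_mono_right [CompleteSpace E] (n : ℤ) (x : E) (f : L2 E) :
    inner ℂ f (mono E n x) = inner ℂ (coeffL E n f) x := by
  rw [← inner_conj_symm, inner_mono_left, inner_conj_symm]

theorem coeffL_mono [CompleteSpace E] (m n : ℤ) (x : E) :
    coeffL E m (mono E n x) = if m = n then x else 0 := by
  refine ext_inner_left ℂ fun v => ?_
  rw [← inner_mono_left, L2.inner_def]
  have h : ∫ t, inner ℂ (mono E m v t) (mono E n x t) ∂mu
      = ∫ t, (fourier (-m) t • fourier n t : ℂ) * inner ℂ v x ∂mu := by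
    refine integral_congr_ae ?_
    filter_upwards [coeFn_mono m v, coeFn_mono n x] with t h₁ h₂
    rw [h₁, h₂, inner_smul_left, inner_smul_right, ← fourier_neg, ← mul_assoc, smul_eq_mul]
  rw [h, integral_mul_const]
  change fourierCoeff (fourier n) m * _ = _
  rw [fourierCoeff_fourier]
  split_ifs with hmn
  · simp [hmn]
  · simp [hmn]

/-- The Fourier expansion in `L²(E)`. -/
theorem hasSum_mono [FiniteDimensional ℂ E] (f : L2 E) :
    HasSum (fun n => mono E n (coeffL E n f)) f := by
  have : CompleteSpace E := FiniteDimensional.complete ℂ E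
  -- Reduction to scalar Fourier series: `C i` extracts the `i`-th coordinate and `J i` puts it back
  -- along `b i`.
  let b := stdOrthonormalBasis ℂ E
  let C (i) : L2 E →L[ℂ] L2 ℂ := (innerSL ℂ (b i)).compLpL 2 mu
  let J (i) : L2 ℂ →L[ℂ] L2 E := ((1 : ℂ →L[ℂ] ℂ).smulRight (b i)).compLpL 2 mu
  have hf : ∑ i, J i (C i f) = f := by
    refine Lp.ext ?_
    have h : ∀ᵐ t ∂mu, ∀ i, J i (C i f) t = inner ℂ (b i) (f t) • b i := by
      refine ae_all_iff.2 fun i => ?_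
      filter_upwards [ContinuousLinearMap.coeFn_compLpL (p := 2) (μ := mu)
        ((1 : ℂ →L[ℂ] ℂ).smulRight (b i)) (C i f),
        ContinuousLinearMap.coeFn_compLpL (p := 2) (μ := mu) (innerSL ℂ (b i)) f] with t h₁ h₂
      refine h₁.trans ?_
      change (C i f) t • b i = _
      rw [h₂]; rfl
    filter_upwards [h, Lp.coeFn_fun_finsetSum Finset.univ (fun i => J i (C i f))] with t h₁ h₂
    rw [h₂]
    simp only [h₁]
    exact b.sum_repr' _
  have hJ (i) (n : ℤ) (c : ℂ) : J i (c • fourierLp 2 n) = mono E n (c • b i) := by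
    rw [map_smul, map_smul]
    congr 1
    refine Lp.ext ?_
    filter_upwards [ContinuousLinearMap.coeFn_compLpL (p := 2) (μ := mu)
        ((1 : ℂ →L[ℂ] ℂ).smulRight (b i)) (fourierLp 2 n), coeFn_fourierLp (T := 2 * Real.pi) 2 n,
        coeFn_mono n (b i)] with t h₁ h₂ h₃
    rw [h₃]
    refine h₁.trans ?_
    rw [h₂]; rfl
  have hC (i) (n : ℤ) : fourierCoeff (C i f) n = inner ℂ (b i) (coeffL E n f) := by
    rw [← inner_mono_left, L2.inner_def, fourierCoeff]
    refine integral_congr_ae ?_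
    filter_upwards [ContinuousLinearMap.coeFn_compLpL (p := 2) (μ := mu) (innerSL ℂ (b i)) f,
      coeFn_mono n (b i)] with t h₁ h₂
    rw [h₁, h₂, inner_smul_left, fourier_neg]; rfl
  have hsum : HasSum (fun n => ∑ i, J i (fourierCoeff (C i f) n • fourierLp 2 n))
      (∑ i, J i (C i f)) :=
    hasSum_sum fun i _ => (J i).hasSum (hasSum_fourier_series_L2 (C i f))
  rw [hf] at hsum
  convert hsum using 2 with n
  simp only [hJ, hC]
  rw [← map_sum, b.sum_repr']

end Multiplication

/-! ### The model space, its bounded functions and its backward shift -/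

section ModelSpace

variable {E : Type*} [NormedAddCommGroup E] [InnerProductSpace ℂ E]

variable (E) in
/-- The bounded functions in `L²(E)`. -/
def bounded : Submodule ℂ (L2 E) where
  carrier := {f | MemLp f ∞ mu}
  add_mem' {f g} hf hg := (MemLp.add hf hg).ae_eq (Lp.coeFn_add f g).symm
  zero_mem' := (MemLp.zero (ε := E)).ae_eq (Lp.coeFn_zero E 2 mu).symm
  smul_mem' c f hf := (MemLp.const_smul hf c).ae_eq (Lp.coeFn_smul c f).symm

theorem coeffL_eq_zero_of_mem_H2 {f : L2 E} (hf : f ∈ H2 E) {n : ℤ} (hn : n < 0) :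
    coeffL E n f = 0 :=
  mem_H2.1 hf n hn

theorem mulChar_mem_H2 {f : L2 E} (hf : f ∈ H2 E) (n : ℕ) : mulChar E n f ∈ H2 E := by
  refine mem_H2.2 fun m hm => ?_
  rw [← coeffL_apply, coeffL_mulChar]
  exact coeffL_eq_zero_of_mem_H2 hf (by lia)

theorem mono_mem_H2 [CompleteSpace E] (n : ℕ) (x : E) : mono E n x ∈ H2 E := by
  refine mem_H2.2 fun m hm => ?_
  rw [← coeffL_apply, coeffL_mono, if_neg (by lia)]

theorem hasSum_mono_nat [FiniteDimensional ℂ E] {f : L2 E} (hf : f ∈ H2 E) :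
    HasSum (fun n : ℕ => mono E n (coeffL E n f)) f := by
  refine (Function.Injective.hasSum_iff (f := fun n : ℤ => mono E n (coeffL E n f))
    Nat.cast_injective fun n hn => ?_).2 (hasSum_mono f)
  have hn' : n < 0 := by
    by_contra! h
    exact hn ⟨n.toNat, Int.toNat_of_nonneg h⟩
  rw [coeffL_eq_zero_of_mem_H2 hf hn', map_zero]

theorem coe_mem_H2 {Θ : T → E →L[ℂ] E} (f : modelSpace Θ) : (f : L2 E) ∈ H2 E := f.2.1

variable [FiniteDimensional ℂ E] {Θ : T → E →L[ℂ] E}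

/-- The difference of `w` and the polynomial has only negative frequencies, hence is orthogonal to
`H²(E)`. -/
theorem inner_eq_inner_sum_of_mem_H2 {w : L2 E} {n : ℕ} (hw : ∀ k : ℤ, n < k → coeffL E k w = 0)
    {h : L2 E} (hh : h ∈ H2 E) :
    inner ℂ h w = inner ℂ h (∑ k ∈ Finset.range (n + 1), mono E k (coeffL E k w)) := by
  have : CompleteSpace E := FiniteDimensional.complete ℂ E
  set p : L2 E := ∑ k ∈ Finset.range (n + 1), mono E k (coeffL E k w) with hp
  have hz (k : ℕ) : coeffL E k (w - p) = 0 := by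
    rw [map_sub, hp, map_sum]
    simp only [coeffL_mono, Nat.cast_inj, Finset.sum_ite_eq, Finset.mem_range]
    split_ifs with hk
    · exact sub_self _
    · rw [sub_zero]
      exact hw k (by lia)
  have hs := (innerSL ℂ (w - p)).hasSum (hasSum_mono_nat hh)
  have hs0 : (fun k : ℕ => innerSL ℂ (w - p) (mono E k (coeffL E k h))) = fun _ => 0 := by
    funext k
    rw [innerSL_apply_apply, inner_mono_right, hz, inner_zero_left]
  rw [hs0] at hs
  rw [← sub_eq_zero, ← inner_sub_right, inner_eq_zero_symm]
  exact hs.unique hasSum_zero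

theorem IsInner.isIsometryField (hΘ : IsInner Θ) : IsIsometryField Θ where
  aestronglyMeasurable := hΘ.memLp.aestronglyMeasurable
  norm_map_ae := by
    have : CompleteSpace E := FiniteDimensional.complete ℂ E
    filter_upwards [hΘ.unitary_ae] with t ht v
    exact ContinuousLinearMap.norm_map_of_mem_unitary ht v

/-- Multiplication by the inner function `Θ` on `L²(E)`. -/
noncomputable abbrev IsInner.mul (hΘ : IsInner Θ) : L2 E →ₗᵢ[ℂ] L2 E :=
  mulIsometry hΘ.isIsometryField

theorem IsInner.coeffL_mul_mono_zero (hΘ : IsInner Θ) (n : ℤ) (x : E) :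
    coeffL E n (hΘ.mul (mono E 0 x)) = fourierCoeff Θ n x := by
  have : CompleteSpace E := FiniteDimensional.complete ℂ E
  have hint : Integrable (fun t => (fourier (-n) t : ℂ) • Θ t) mu :=
    (hΘ.memLp.integrable (by norm_num)).fourier_smul (-n)
  rw [coeffL_apply, fourierCoeff, fourierCoeff, ContinuousLinearMap.integral_apply hint]
  refine integral_congr_ae ?_
  filter_upwards [coeFn_mulIsometry hΘ.isIsometryField (mono E 0 x), coeFn_mono 0 x] with t h₁ h₂
  rw [h₁, h₂, fourier_zero, one_smul, _root_.smul_apply]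

theorem IsInner.mul_mono_zero_mem_H2 (hΘ : IsInner Θ) (x : E) : hΘ.mul (mono E 0 x) ∈ H2 E := by
  refine mem_H2.2 fun n hn => ?_
  rw [← coeffL_apply, hΘ.coeffL_mul_mono_zero, hΘ.coeff_eq_zero n hn, _root_.zero_apply]

theorem IsInner.mul_mono_mem_H2 (hΘ : IsInner Θ) (n : ℕ) (x : E) :
    hΘ.mul (mono E n x) ∈ H2 E := by
  have h : mono E n x = mulChar E n (mono E 0 x) := by rw [mulChar_mono, add_zero]
  rw [h, mulIsometry_mulChar]
  exact mulChar_mem_H2 (hΘ.mul_mono_zero_mem_H2 x) n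

theorem IsInner.mul_mem_H2 (hΘ : IsInner Θ) {f : L2 E} (hf : f ∈ H2 E) : hΘ.mul f ∈ H2 E :=
  isClosed_H2.mem_of_tendsto
    ((hasSum_mono_nat hf).map hΘ.mul hΘ.mul.continuous)
    (Filter.Eventually.of_forall fun _ =>
      Submodule.sum_mem _ fun n _ => hΘ.mul_mono_mem_H2 n _)

theorem IsInner.mem_thetaH2 (hΘ : IsInner Θ) {g : L2 E} :
    g ∈ thetaH2 Θ ↔ ∃ f ∈ H2 E, hΘ.mul f = g := by
  refine exists_congr fun f => and_congr_right fun _ => ⟨fun h => ?_, fun h => ?_⟩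
  · exact Lp.ext ((coeFn_mulIsometry _ f).trans h.symm)
  · rw [← h]
    exact coeFn_mulIsometry _ f

theorem IsInner.mem_modelSpace (hΘ : IsInner Θ) {f : L2 E} :
    f ∈ modelSpace Θ ↔ f ∈ H2 E ∧ ∀ h ∈ H2 E, inner ℂ (hΘ.mul h) f = 0 := by
  refine and_congr_right fun _ => ⟨fun hf h hh => ?_, fun hf => ?_⟩
  · exact hf _ (hΘ.mem_thetaH2.2 ⟨h, hh, rfl⟩)
  · rintro g hg
    obtain ⟨h, hh, rfl⟩ := hΘ.mem_thetaH2.1 hg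
    exact hf h hh

/-- The projections of monomials onto the model space: the vectors representing the Fourier
coefficients on the model space. -/
noncomputable def coeffRep (Θ : T → E →L[ℂ] E) (n : ℤ) : E →L[ℂ] modelSpace Θ :=
  (modelSpace Θ).orthogonalProjectionOnto ∘L mono E n

theorem inner_coeffRep_left (n : ℤ) (x : E) (f : modelSpace Θ) :
    inner ℂ (coeffRep Θ n x) f = inner ℂ x (coeffL E n f) := by
  have : CompleteSpace E := FiniteDimensional.complete ℂ E
  rw [← inner_mono_left]
  exact Submodule.inner_orthogonalProjectionOnto_eq_of_mem_right f (mono E n x)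

/-- The projection of a monomial onto the model space is bounded: it differs from the monomial
by `Θ` times a polynomial. -/
theorem IsInner.memLp_top_coeffRep (hΘ : IsInner Θ) (n : ℕ) (x : E) :
    MemLp (coeffRep Θ n x : L2 E) ∞ mu := by
  have : CompleteSpace E := FiniteDimensional.complete ℂ E
  -- Here `w = Θ* zⁿ x`; its analytic part `p` is a polynomial, and the projection will be `zⁿ x - Θ
  -- p`.
  set w : L2 E := ContinuousLinearMap.adjoint hΘ.mul.toContinuousLinearMap (mono E n x)
  have hinner (h : L2 E) : inner ℂ (hΘ.mul h) (mono E n x) = inner ℂ h w :=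
    (ContinuousLinearMap.adjoint_inner_right hΘ.mul.toContinuousLinearMap h (mono E n x)).symm
  -- Pairing `Θ zᵏ y` with `zⁿ x` reads the coefficient of `Θ y` at `n - k < 0`.
  have hwz (k : ℤ) (hk : n < k) : coeffL E k w = 0 := by
    refine ext_inner_left ℂ fun y => ?_
    have h : mono E k y = mulChar E k (mono E 0 y) := by rw [mulChar_mono, add_zero]
    rw [← inner_mono_left, ← hinner, h, mulIsometry_mulChar, inner_mono_right, coeffL_mulChar,
      coeffL_eq_zero_of_mem_H2 (hΘ.mul_mono_zero_mem_H2 y) (by lia), inner_zero_left,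
      inner_zero_right]
  set p : L2 E := ∑ k ∈ Finset.range (n + 1), mono E k (coeffL E k w)
  have hpH : p ∈ H2 E := Submodule.sum_mem _ fun k _ => mono_mem_H2 k _
  have hmem : mono E n x - hΘ.mul p ∈ modelSpace Θ := by
    refine hΘ.mem_modelSpace.2 ⟨Submodule.sub_mem _ (mono_mem_H2 n x) (hΘ.mul_mem_H2 hpH),
      fun h hh => ?_⟩
    rw [inner_sub_right, hinner, inner_eq_inner_sum_of_mem_H2 hwz hh, LinearIsometry.inner_map_map, sub_self]
  have hproj : (coeffRep Θ n x : L2 E) = mono E n x - hΘ.mul p := by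
    refine (modelSpace Θ).eq_starProjection_of_mem_of_inner_eq_zero hmem fun g hg => ?_
    refine (congrArg (inner ℂ · g) (sub_sub_cancel _ _)).trans ?_
    exact (hΘ.mem_modelSpace.1 hg).2 p hpH
  rw [hproj]
  have hpb : p ∈ bounded E := Submodule.sum_mem _ fun k _ => memLp_top_mono k _
  exact Submodule.sub_mem (bounded E) (memLp_top_mono n x) (memLp_top_mulIsometry _ hpb)

variable (Θ) in
/-- The bounded functions in the model space. -/
noncomputable def boundedModel : Submodule ℂ (modelSpace Θ) := (bounded E).comap (modelSpace Θ).subtype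

instance completeSpace_modelSpace : CompleteSpace (modelSpace Θ) := by
  have : CompleteSpace E := FiniteDimensional.complete ℂ E
  exact (isClosed_H2.inter (Submodule.isClosed_orthogonal (thetaH2 Θ))).completeSpace_coe

/-- A function orthogonal to all the bounded vectors `P_Θ (zⁿ x)` has no nonzero Taylor coefficient.
-/
theorem IsInner.dense_boundedModel (hΘ : IsInner Θ) : Dense (boundedModel Θ : Set (modelSpace Θ)) := by
  rw [Submodule.dense_iff_topologicalClosure_eq_top, Submodule.topologicalClosure_eq_top_iff,
    Submodule.eq_bot_iff]
  intro f hf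
  have h : ∀ n : ℕ, coeffL E n (f : L2 E) = 0 := fun n => ext_inner_left ℂ fun x => by
    rw [← inner_coeffRep_left, hf _ (hΘ.memLp_top_coeffRep n x), inner_zero_right]
  refine Subtype.ext ((hasSum_mono_nat (coe_mem_H2 f)).unique ?_)
  simp only [h, map_zero]
  exact hasSum_zero

/-- The functions in the model space that vanish at the origin are limits of bounded ones. -/
theorem IsInner.mem_closure_bounded_of_coeffL_zero (hΘ : IsInner Θ) {f : modelSpace Θ}
    (hf : coeffL E 0 (f : L2 E) = 0) :
    f ∈ closure {g : modelSpace Θ | MemLp (g : L2 E) ∞ mu ∧ coeffL E 0 (g : L2 E) = 0} := by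
  -- `Dᗮ` is the space of functions vanishing at 0. Since `D` consists of bounded functions,
  -- projecting onto `Dᗮ` preserves boundedness, so bounded approximants of `f` can be corrected to
  -- vanish at 0.
  set D : Submodule ℂ (modelSpace Θ) := (coeffRep Θ 0).range
  have hD {g : modelSpace Θ} : g ∈ Dᗮ ↔ coeffL E 0 (g : L2 E) = 0 := by
    refine ⟨fun h => ext_inner_left ℂ fun x => ?_, ?_⟩
    · rw [← inner_coeffRep_left, inner_zero_right]
      exact h _ ⟨x, rfl⟩
    · rintro h _ ⟨x, rfl⟩
      exact (inner_coeffRep_left 0 x g).trans (by rw [h, inner_zero_right])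
  have hfix : Dᗮ.starProjection f = f := Submodule.starProjection_eq_self_iff.2 (hD.2 hf)
  rw [← hfix]
  refine map_mem_closure Dᗮ.starProjection.continuous (hΘ.dense_boundedModel f) fun g hg => ?_
  refine ⟨?_, hD.1 (Submodule.starProjection_apply_mem _ g)⟩
  change _ ∈ boundedModel Θ
  rw [Submodule.starProjection_orthogonal_val]
  refine Submodule.sub_mem _ hg ?_
  obtain ⟨x, hx⟩ : D.starProjection g ∈ D := Submodule.starProjection_apply_mem _ g
  rw [← hx]
  exact hΘ.memLp_top_coeffRep 0 x

/-- For `h` in `H²(E)`, moving `z` across turns the pairing with `Θ h` into one with `z Θ h = Θ (z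
h)`, which is orthogonal both to constants and to `f`. -/
theorem IsInner.backwardShift_mem (hΘ : IsInner Θ) {f : L2 E} (hf : f ∈ modelSpace Θ) :
    mulChar E (-1) (f - mono E 0 (coeffL E 0 f)) ∈ modelSpace Θ := by
  have : CompleteSpace E := FiniteDimensional.complete ℂ E
  rw [hΘ.mem_modelSpace] at hf ⊢
  refine ⟨mem_H2.2 fun n hn => ?_, fun h hh => ?_⟩
  · rw [← coeffL_apply, coeffL_mulChar, map_sub, coeffL_mono]
    split_ifs with h0
    · rw [h0, sub_self]
    · rw [sub_zero]
      exact coeffL_eq_zero_of_mem_H2 hf.1 (by lia)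
  · have h1 := mulChar_mem_H2 hh 1
    rw [← inner_mulChar_left, inner_sub_right, inner_mono_right, coeffL_mulChar,
      coeffL_eq_zero_of_mem_H2 (hΘ.mul_mem_H2 hh) (by lia), inner_zero_left, sub_zero,
      ← mulIsometry_mulChar]
    exact hf.2 _ h1

/-- The backward shift on the model space. -/
noncomputable def IsInner.backwardShift (hΘ : IsInner Θ) : modelSpace Θ →L[ℂ] modelSpace Θ :=
  ((mulChar E (-1)).toContinuousLinearMap ∘L
    (ContinuousLinearMap.id ℂ (L2 E) - mono E 0 ∘L coeffL E 0) ∘L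
      (modelSpace Θ).subtypeL).codRestrict (modelSpace Θ) fun f => hΘ.backwardShift_mem f.2

theorem IsInner.coe_backwardShift (hΘ : IsInner Θ) (f : modelSpace Θ) :
    (hΘ.backwardShift f : L2 E) = mulChar E (-1) (f - mono E 0 (coeffL E 0 (f : L2 E))) := rfl

theorem IsInner.mulChar_backwardShift (hΘ : IsInner Θ) (f : modelSpace Θ) :
    mulChar E 1 (hΘ.backwardShift f : L2 E) = f - mono E 0 (coeffL E 0 (f : L2 E)) := by
  rw [hΘ.coe_backwardShift, mulChar_mulChar, add_neg_cancel, mulChar_zero]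

/-- The index -1 is excluded because the removed constant term would land there. -/
theorem IsInner.coeffL_backwardShift (hΘ : IsInner Θ) {n : ℤ} (hn : n ≠ -1) (f : modelSpace Θ) :
    coeffL E n (hΘ.backwardShift f : L2 E) = coeffL E (n + 1) (f : L2 E) := by
  have : CompleteSpace E := FiniteDimensional.complete ℂ E
  rw [hΘ.coe_backwardShift, coeffL_mulChar, map_sub, coeffL_mono, sub_neg_eq_add,
    if_neg (by lia), sub_zero]

theorem IsInner.coeffL_backwardShift_pow (hΘ : IsInner Θ) (n : ℕ) (f : modelSpace Θ) :
    coeffL E 0 ((hΘ.backwardShift ^ n) f : L2 E) = coeffL E n (f : L2 E) := by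
  have h (k : ℕ) : coeffL E k ((hΘ.backwardShift ^ n) f : L2 E)
      = coeffL E (k + n : ℕ) (f : L2 E) := by
    induction n generalizing k with
    | zero => rfl
    | succ n ih =>
      rw [pow_succ', mul_apply_eq_comp, hΘ.coeffL_backwardShift (by lia)]
      refine (ih (k + 1)).trans ?_
      rw [add_assoc, add_comm 1 n]
  simpa using h 0

/-- Each constant removed by the backward shift is orthogonal to `z H²(E)`. -/
theorem IsInner.inner_backwardShift_pow (hΘ : IsInner Θ) (n : ℕ) (f : modelSpace Θ) {g : L2 E}
    (hg : g ∈ H2 E) :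
    inner ℂ ((hΘ.backwardShift ^ n) f : L2 E) g = inner ℂ (f : L2 E) (mulChar E n g) := by
  have : CompleteSpace E := FiniteDimensional.complete ℂ E
  induction n generalizing g with
  | zero => simp [mulChar_zero]
  | succ n ih =>
    have h1 := mulChar_mem_H2 hg 1
    rw [pow_succ', mul_apply_eq_comp, ← (mulChar E 1).inner_map_map,
      hΘ.mulChar_backwardShift, inner_sub_left, inner_mono_left, coeffL_mulChar,
      coeffL_eq_zero_of_mem_H2 hg (by lia), inner_zero_right, sub_zero]
    refine (ih h1).trans ?_
    rw [Nat.cast_one, mulChar_mulChar, Nat.cast_succ]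

theorem IsInner.mulChar_backwardShift_pow (hΘ : IsInner Θ) (n : ℕ) (f : modelSpace Θ) :
    mulChar E n ((hΘ.backwardShift ^ n) f : L2 E)
      = f - ∑ k ∈ Finset.range n, mono E k (coeffL E k (f : L2 E)) := by
  induction n with
  | zero => simp [mulChar_zero]
  | succ n ih =>
    rw [pow_succ', mul_apply_eq_comp, Nat.cast_succ, ← mulChar_mulChar,
      hΘ.mulChar_backwardShift, map_sub, ih, hΘ.coeffL_backwardShift_pow, mulChar_mono, add_zero,
      Finset.sum_range_succ, sub_sub]

/-- Multiplication by `zⁿ` is isometric, so the norm is that of the `n`-th Taylor tail of `f`. -/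
theorem IsInner.tendsto_backwardShift_pow (hΘ : IsInner Θ) (f : modelSpace Θ) :
    Filter.Tendsto (fun n : ℕ => (hΘ.backwardShift ^ n) f) Filter.atTop (nhds 0) := by
  have h := (hasSum_mono_nat (coe_mem_H2 f)).tendsto_sum_nat.const_sub (f : L2 E)
  rw [sub_self] at h
  refine tendsto_zero_iff_norm_tendsto_zero.2 (h.norm.congr' ?_ |>.trans (by simp))
  refine Filter.Eventually.of_forall fun n => ?_
  change ‖(f : L2 E) - _‖ = _
  rw [← hΘ.mulChar_backwardShift_pow, LinearIsometry.norm_map]; rfl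

end ModelSpace

/-! ### Sesquilinear forms vanishing on a kernel -/

section Abstract

variable {H : Type*} [NormedAddCommGroup H] [InnerProductSpace ℂ H]

/-- Complex polarization, using `f + g` and `f + i g`. -/
theorem inner_map_eq_zero_of_inner_map_self {N : Submodule ℂ H} {Q : H →L[ℂ] H}
    (hQ : ∀ f ∈ N, inner ℂ f (Q f) = 0) {f g : H} (hf : f ∈ N) (hg : g ∈ N) :
    inner ℂ g (Q f) = 0 := by
  have h₁ := hQ _ (N.add_mem hf hg)
  have h₂ := hQ _ (N.add_mem hf (N.smul_mem Complex.I hg))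
  simp only [map_add, map_smul, inner_add_left, inner_add_right, inner_smul_left,
    inner_smul_right, hQ f hf, hQ g hg, Complex.conj_I] at h₁ h₂
  linear_combination (1 / 2 : ℂ) * h₁ + (Complex.I / 2) * h₂
    + (1 / 2 : ℂ) * (inner ℂ g (Q f) - inner ℂ f (Q g)) * Complex.I_sq

/-- A bounded operator whose sesquilinear form vanishes on the kernel of a map of finite rank. -/
theorem exists_inner_map_eq_add [CompleteSpace H] {E : Type*} [NormedAddCommGroup E]
    [InnerProductSpace ℂ E] [FiniteDimensional ℂ E] (ev : H →L[ℂ] E) (Q : H →L[ℂ] H)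
    (hQ : ∀ f g, ev f = 0 → ev g = 0 → inner ℂ g (Q f) = 0) :
    ∃ B B' : E →L[ℂ] H, ∀ f g, inner ℂ g (Q f) = inner ℂ g (B (ev f)) + inner ℂ (B' (ev g)) f := by
  -- `R` extends a linear section of `ev` over its range to all of `E`, and is bounded as `E` is
  -- finite-dimensional. Then `f - R (ev f)` lies in the kernel of `ev`.
  obtain ⟨r, hr⟩ := ev.toLinearMap.rangeRestrict.exists_rightInverse_of_surjective
    ev.toLinearMap.range_rangeRestrict
  obtain ⟨R₀, hR₀⟩ := r.exists_extend
  let R : E →L[ℂ] H := R₀.toContinuousLinearMap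
  have hR (f : H) : ev (f - R (ev f)) = 0 := by
    have h₁ : R (ev f) = r (ev.toLinearMap.rangeRestrict f) := LinearMap.congr_fun hR₀ (ev.toLinearMap.rangeRestrict f)
    have h₂ := congrArg Subtype.val (LinearMap.congr_fun hr (ev.toLinearMap.rangeRestrict f))
    have h₃ : ev (R (ev f)) = ev f := by
      rw [h₁]
      exact h₂
    rw [map_sub, h₃, sub_self]
  -- The witnesses are read off from `⟨g, Q f⟩ = ⟨g, Q R ev f⟩ + ⟨R ev g, Q (f - R ev f)⟩`, valid
  -- because `⟨g - R ev g, Q (f - R ev f)⟩ = 0`.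
  refine ⟨Q ∘L R, ContinuousLinearMap.adjoint
    (Q ∘L (ContinuousLinearMap.id ℂ H - R ∘L ev)) ∘L R, fun f g => ?_⟩
  have h := hQ _ _ (hR f) (hR g)
  rw [inner_sub_left, map_sub, inner_sub_right] at h
  rw [ContinuousLinearMap.comp_apply, ContinuousLinearMap.comp_apply,
    ContinuousLinearMap.adjoint_inner_left]
  change _ = _ + inner ℂ (R (ev g)) (Q (f - R (ev f)))
  rw [map_sub]
  linear_combination h

end Abstract

/-! ### Square integrable symbols acting on bounded functions -/

section Symbols

theorem memLp_two_add {F : Type*} [NormedAddCommGroup F] {f g : T → F} (hf : MemLp f 2 mu)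
    (hg : MemLp g 2 mu) : MemLp (fun t => f t + g t) 2 mu :=
  hf.add hg

theorem memLp_two_sum {F ι : Type*} [NormedAddCommGroup F] (s : Finset ι) {f : ι → T → F}
    (hf : ∀ i, MemLp (f i) 2 mu) : MemLp (fun t => ∑ i ∈ s, f i t) 2 mu :=
  memLp_finsetSum s fun i _ => hf i

variable {E : Type*} [NormedAddCommGroup E] [InnerProductSpace ℂ E]

theorem coeFn_mulSymbol {Φ : T → E →L[ℂ] E} (hΦ : MemLp Φ 2 mu) {f : L2 E} (hf : MemLp f ∞ mu) :
    mulSymbol hΦ hf =ᵐ[mu] fun t => Φ t (f t) :=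
  MemLp.coeFn_toLp (memLp_mul hΦ hf)

theorem memLp_top_mulChar (n : ℤ) {f : L2 E} (hf : MemLp f ∞ mu) : MemLp (mulChar E n f) ∞ mu :=
  memLp_top_mulIsometry (isIsometryField_fourier n) hf

theorem mulChar_mulSymbol {Φ : T → E →L[ℂ] E} (hΦ : MemLp Φ 2 mu) {f : L2 E}
    (hf : MemLp f ∞ mu) (n : ℤ) :
    mulChar E n (mulSymbol hΦ hf)
      = mulSymbol hΦ (memLp_top_mulChar n hf) := by
  refine Lp.ext ?_
  filter_upwards [coeFn_mulChar n (mulSymbol hΦ hf), coeFn_mulSymbol hΦ hf,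
    coeFn_mulSymbol hΦ (memLp_top_mulChar n hf),
    coeFn_mulChar n f] with t h₁ h₂ h₃ h₄
  rw [h₁, h₂, h₃]
  rw [h₄, map_smul]

theorem mulSymbol_add {Φ Ψ Ξ : T → E →L[ℂ] E} (hΦ : MemLp Φ 2 mu) (hΨ : MemLp Ψ 2 mu)
    (hΞ : MemLp Ξ 2 mu) (h : ∀ t, Ξ t = Φ t + Ψ t) {f : L2 E} (hf : MemLp f ∞ mu) :
    mulSymbol hΞ hf = mulSymbol hΦ hf + mulSymbol hΨ hf := by
  refine Lp.ext ?_
  filter_upwards [coeFn_mulSymbol hΞ hf, coeFn_mulSymbol hΦ hf, coeFn_mulSymbol hΨ hf,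
    Lp.coeFn_add (mulSymbol hΦ hf) (mulSymbol hΨ hf)] with t h₁ h₂ h₃ h₄
  rw [h₁, h₄, Pi.add_apply, h₂, h₃, h, _root_.add_apply]

theorem memLp_adjoint [CompleteSpace E] {Φ : T → E →L[ℂ] E} (hΦ : MemLp Φ 2 mu) :
    MemLp (fun t => ContinuousLinearMap.adjoint (Φ t)) 2 mu := by
  refine hΦ.of_le (ContinuousLinearMap.adjoint.continuous.comp_aestronglyMeasurable
    hΦ.aestronglyMeasurable) (ae_of_all _ fun t => ?_)
  rw [LinearIsometryEquiv.norm_map]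

/-- With the symbol moved onto the bounded factor `g`, the pairing is continuous in `f` for the `L²`
norm, so Fourier series can be inserted even though `Φ` may be unbounded. -/
theorem inner_mulSymbol_adjoint [CompleteSpace E] {Φ : T → E →L[ℂ] E} (hΦ : MemLp Φ 2 mu)
    {g : L2 E} (hg : MemLp g ∞ mu) {f h : L2 E} (hh : h =ᵐ[mu] fun t => Φ t (f t)) :
    inner ℂ (mulSymbol (memLp_adjoint hΦ) hg) f = inner ℂ g h := by
  rw [L2.inner_def, L2.inner_def]
  refine integral_congr_ae ?_
  filter_upwards [coeFn_mulSymbol (memLp_adjoint hΦ) hg, hh] with t h₁ h₂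
  rw [h₁, h₂, ContinuousLinearMap.adjoint_inner_left]

variable [FiniteDimensional ℂ E]

/-- The operator-valued function `Ψ` with `Ψ x = B x` for every `x`. -/
noncomputable def symbolOf (B : E →L[ℂ] L2 E) (t : T) : E →L[ℂ] E :=
  ∑ i, (innerSL ℂ (stdOrthonormalBasis ℂ E i)).smulRight (B (stdOrthonormalBasis ℂ E i) t)

theorem memLp_symbolOf (B : E →L[ℂ] L2 E) : MemLp (symbolOf B) 2 mu := by
  have h (i) : MemLp (fun t => (innerSL ℂ (stdOrthonormalBasis ℂ E i)).smulRight
      (B (stdOrthonormalBasis ℂ E i) t)) 2 mu :=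
    (ContinuousLinearMap.smulRightL ℂ E E (innerSL ℂ (stdOrthonormalBasis ℂ E i))).comp_memLp'
      (Lp.memLp (B (stdOrthonormalBasis ℂ E i)))
  exact memLp_two_sum Finset.univ h

theorem symbolOf_apply (B : E →L[ℂ] L2 E) (x : E) : (fun t => symbolOf B t x) =ᵐ[mu] B x := by
  set b := stdOrthonormalBasis ℂ E
  have hx : B x = ∑ i, (inner ℂ (b i) x : ℂ) • B (b i) := by
    conv_lhs => rw [← b.sum_repr' x]
    simp only [map_sum, map_smul]
  have h : ∀ᵐ t ∂mu, ∀ i, ((inner ℂ (b i) x : ℂ) • B (b i)) t = (inner ℂ (b i) x : ℂ) • B (b i) t :=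
    ae_all_iff.2 fun i => Lp.coeFn_smul _ _
  rw [hx]
  filter_upwards [h, Lp.coeFn_fun_finsetSum Finset.univ
    (fun i => (inner ℂ (b i) x : ℂ) • B (b i))] with t h₁ h₂
  rw [h₂, symbolOf, _root_.sum_apply]
  refine Finset.sum_congr rfl fun i _ => ?_
  rw [h₁]; rfl

theorem coeFn_mulChar_symbolOf (B : E →L[ℂ] L2 E) (n : ℤ) (x : E) :
    mulChar E n (B x) =ᵐ[mu] fun t => symbolOf B t (mono E n x t) := by
  filter_upwards [coeFn_mulChar n (B x), symbolOf_apply B x, coeFn_mono n x] with t h₁ h₂ h₃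
  rw [h₁, h₃, map_smul, h₂]

theorem inner_mulSymbol_symbolOf_mono [CompleteSpace E] (B : E →L[ℂ] L2 E) {g : L2 E}
    (hg : MemLp g ∞ mu) (n : ℤ) (x : E) :
    inner ℂ (mulSymbol (memLp_adjoint (memLp_symbolOf B)) hg) (mono E n x)
      = inner ℂ g (mulChar E n (B x)) :=
  inner_mulSymbol_adjoint (memLp_symbolOf B) hg (coeFn_mulChar_symbolOf B n x)

theorem inner_mono_mulSymbol_symbolOf [CompleteSpace E] (B : E →L[ℂ] L2 E) {g : L2 E}
    (hg : MemLp g ∞ mu) (n : ℤ) (x : E) :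
    inner ℂ (mono E n x) (mulSymbol (memLp_adjoint (memLp_symbolOf B)) hg)
      = inner ℂ (mulChar E n (B x)) g := by
  rw [← inner_conj_symm, inner_mulSymbol_symbolOf_mono, inner_conj_symm]

end Symbols

/-! ### Shift invariance and the construction of the symbol -/

section Main

variable {E : Type*} [NormedAddCommGroup E] [InnerProductSpace ℂ E] [FiniteDimensional ℂ E]
  {Θ : T → E →L[ℂ] E}

theorem IsInner.isShiftInvariant_iff (hΘ : IsInner Θ) (A : modelSpace Θ →L[ℂ] modelSpace Θ) :
    IsShiftInvariant A ↔ ∀ f : modelSpace Θ, coeffL E 0 (f : L2 E) = 0 →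
      inner ℂ f (A f) = inner ℂ (hΘ.backwardShift f) (A (hΘ.backwardShift f)) := by
  refine ⟨fun h f hf => ?_, fun h f hf => ?_⟩
  · have hs : shift (hΘ.backwardShift f : L2 E) = f := by
      rw [shift_eq_mulChar, hΘ.mulChar_backwardShift, hf, map_zero, sub_zero]
    have hm : shift (hΘ.backwardShift f : L2 E) ∈ modelSpace Θ := hs ▸ f.2
    have he : (⟨_, hm⟩ : modelSpace Θ) = f := Subtype.ext hs
    have := h (hΘ.backwardShift f) hm
    rw [he] at this
    exact this.symm
  · have h0 : coeffL E 0 (shift (f : L2 E)) = 0 := by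
      rw [shift_eq_mulChar, coeffL_mulChar]
      exact coeffL_eq_zero_of_mem_H2 (coe_mem_H2 f) (by lia)
    have he : hΘ.backwardShift ⟨shift (f : L2 E), hf⟩ = f := by
      refine Subtype.ext ?_
      rw [hΘ.coe_backwardShift, h0, map_zero, sub_zero]
      change mulChar E (-1) (shift (f : L2 E)) = f
      rw [shift_eq_mulChar, mulChar_mulChar]
      exact mulChar_zero _
    have := h ⟨_, hf⟩ h0
    rw [he] at this
    exact this.symm

theorem IsInner.isShiftInvariant_of_symbol (hΘ : IsInner Θ) {Φ : T → E →L[ℂ] E}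
    {hΦ : MemLp Φ 2 mu} {A : modelSpace Θ →L[ℂ] modelSpace Θ}
    (hA : IsTruncatedToeplitzWithSymbol hΦ A) : IsShiftInvariant A := by
  rw [hΘ.isShiftInvariant_iff]
  intro f hf
  -- The symbol formula is available only for bounded functions; the identity is a closed condition,
  -- so those vanishing at 0 suffice.
  let S : Set (modelSpace Θ) := {f | inner ℂ f (A f)
    = inner ℂ (hΘ.backwardShift f) (A (hΘ.backwardShift f))}
  have hS : IsClosed S := isClosed_eq (continuous_id.inner A.continuous)
    (hΘ.backwardShift.continuous.inner (A.continuous.comp hΘ.backwardShift.continuous))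
  refine hS.closure_subset_iff.2 ?_ (hΘ.mem_closure_bounded_of_coeffL_zero hf)
  rintro g ⟨hg, hg0⟩
  have hsg : mulChar E 1 (hΘ.backwardShift g : L2 E) = g := by
    rw [hΘ.mulChar_backwardShift, hg0, map_zero, sub_zero]
  have hbg : (hΘ.backwardShift g : L2 E) = mulChar E (-1) g := by
    rw [hΘ.coe_backwardShift, hg0, map_zero, sub_zero]
  have hb : MemLp (hΘ.backwardShift g : L2 E) ∞ mu := by
    rw [hbg]
    exact memLp_top_mulChar (-1) hg
  have hsym : mulChar E 1 (mulSymbol hΦ hb) = mulSymbol hΦ hg := by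
    rw [mulChar_mulSymbol]
    congr 1
  change inner ℂ g (A g) = inner ℂ (hΘ.backwardShift g) (A (hΘ.backwardShift g))
  rw [hA g hg, hA _ hb, Submodule.inner_orthogonalProjectionOnto_eq_of_mem_left,
    Submodule.inner_orthogonalProjectionOnto_eq_of_mem_left,
    ← (mulChar E 1).inner_map_map (hΘ.backwardShift g : L2 E), hsg, hsym]

theorem IsInner.exists_inner_sub_eq (hΘ : IsInner Θ) {A : modelSpace Θ →L[ℂ] modelSpace Θ}
    (hA : IsShiftInvariant A) :
    ∃ B B' : E →L[ℂ] modelSpace Θ, ∀ f g : modelSpace Θ,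
      inner ℂ g (A f) - inner ℂ (hΘ.backwardShift g) (A (hΘ.backwardShift f))
        = inner ℂ (g : L2 E) (B (coeffL E 0 (f : L2 E)) : L2 E)
          + inner ℂ (B' (coeffL E 0 (g : L2 E)) : L2 E) (f : L2 E) := by
  set Z := hΘ.backwardShift
  set Q := A - ContinuousLinearMap.adjoint Z ∘L A ∘L Z
  have hQ (f g : modelSpace Θ) :
      inner ℂ g (Q f) = inner ℂ g (A f) - inner ℂ (Z g) (A (Z f)) := by
    rw [← ContinuousLinearMap.adjoint_inner_right, ← inner_sub_right (𝕜 := ℂ) g]; rfl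
  let ev : modelSpace Θ →L[ℂ] E := coeffL E 0 ∘L (modelSpace Θ).subtypeL
  obtain ⟨B, B', h⟩ := exists_inner_map_eq_add ev Q fun f g hf hg =>
    inner_map_eq_zero_of_inner_map_self (N := ev.ker) (fun k hk => by
      rw [hQ, (hΘ.isShiftInvariant_iff A).1 hA k hk, sub_self]) hf hg
  exact ⟨B, B', fun f g => (hQ f g).symm.trans (h f g)⟩

/-- The partial sums telescope to `⟨g, A f⟩ - ⟨Zᴺ g, A Zᴺ f⟩`, and the remainder vanishes in the
limit. -/
theorem IsInner.tendsto_sum_inner (hΘ : IsInner Θ) {A : modelSpace Θ →L[ℂ] modelSpace Θ}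
    {B B' : E →L[ℂ] modelSpace Θ} (h : ∀ f g : modelSpace Θ,
      inner ℂ g (A f) - inner ℂ (hΘ.backwardShift g) (A (hΘ.backwardShift f))
        = inner ℂ (g : L2 E) (B (coeffL E 0 (f : L2 E)) : L2 E)
          + inner ℂ (B' (coeffL E 0 (g : L2 E)) : L2 E) (f : L2 E)) (f g : modelSpace Θ) :
    Filter.Tendsto (fun N : ℕ => ∑ n ∈ Finset.range N,
      (inner ℂ (g : L2 E) (mulChar E n (B (coeffL E n (f : L2 E))))
        + inner ℂ (mulChar E n (B' (coeffL E n (g : L2 E)) : L2 E)) (f : L2 E)))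
      Filter.atTop (nhds (inner ℂ g (A f))) := by
  set Z := hΘ.backwardShift
  have hsum (N : ℕ) : ∑ n ∈ Finset.range N,
      (inner ℂ (g : L2 E) (mulChar E n (B (coeffL E n (f : L2 E))))
        + inner ℂ (mulChar E n (B' (coeffL E n (g : L2 E)) : L2 E)) (f : L2 E))
      = inner ℂ g (A f) - inner ℂ ((Z ^ N) g) (A ((Z ^ N) f)) := by
    induction N with
    | zero => simp
    | succ N ih =>
      have hN := h ((Z ^ N) f) ((Z ^ N) g)
      rw [hΘ.coeffL_backwardShift_pow, hΘ.coeffL_backwardShift_pow,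
        hΘ.inner_backwardShift_pow N g (coe_mem_H2 _),
        ← inner_conj_symm _ ((Z ^ N) f : L2 E),
        hΘ.inner_backwardShift_pow N f (coe_mem_H2 _), inner_conj_symm] at hN
      rw [Finset.sum_range_succ, ih, ← hN, pow_succ', mul_apply_eq_comp, mul_apply_eq_comp]
      ring
  simp only [hsum]
  have hlim := (hΘ.tendsto_backwardShift_pow g).inner (𝕜 := ℂ)
    ((A.continuous.tendsto 0).comp (hΘ.tendsto_backwardShift_pow f))
  rw [inner_zero_left] at hlim
  simpa using hlim.const_sub (inner ℂ g (A f))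

theorem IsInner.exists_symbol (hΘ : IsInner Θ) {A : modelSpace Θ →L[ℂ] modelSpace Θ}
    (hA : IsShiftInvariant A) : A ∈ truncatedToeplitz Θ := by
  have : CompleteSpace E := FiniteDimensional.complete ℂ E
  obtain ⟨B, B', h⟩ := hΘ.exists_inner_sub_eq hA
  have hΨ := memLp_symbolOf ((modelSpace Θ).subtypeL ∘L B)
  have hX := memLp_adjoint (memLp_symbolOf ((modelSpace Θ).subtypeL ∘L B'))
  -- The symbol is `Ψ + Ψ'*`, where `Ψ` and `Ψ'` are built from `B` and `B'`.
  refine ⟨_, memLp_two_add hΨ hX, fun f hf => ?_⟩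
  refine hΘ.dense_boundedModel.eq_of_inner_right (𝕜 := ℂ) fun g hgb => ?_
  have hg : MemLp (g : L2 E) ∞ mu := hgb
  rw [Submodule.inner_orthogonalProjectionOnto_eq_of_mem_left,
    mulSymbol_add hΨ hX (memLp_two_add hΨ hX) (fun _ => rfl), inner_add_right]
  have hf' := (hasSum_mono_nat (coe_mem_H2 f)).tendsto_sum_nat
  have hg' := (hasSum_mono_nat (coe_mem_H2 g)).tendsto_sum_nat
  -- The series is inserted for `f` in the `Ψ` term and for `g` in the `Ψ'*` term, matching the two
  -- halves of the telescoped sum.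
  have h₁ := (tendsto_const_nhds (x := mulSymbol (memLp_adjoint hΨ) hg)).inner (𝕜 := ℂ) hf'
  have h₂ := hg'.inner (𝕜 := ℂ) (tendsto_const_nhds (x := mulSymbol hX hf))
  rw [inner_mulSymbol_adjoint hΨ hg (coeFn_mulSymbol hΨ hf)] at h₁
  refine tendsto_nhds_unique (hΘ.tendsto_sum_inner h f g) ((h₁.add h₂).congr fun N => ?_)
  rw [inner_sum, sum_inner, ← Finset.sum_add_distrib]
  refine Finset.sum_congr rfl fun n _ => ?_
  rw [inner_mulSymbol_symbolOf_mono, inner_mono_mulSymbol_symbolOf]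
  rfl

end Main

end MTTO

theorem mainTheorem2 {E : Type*} [NormedAddCommGroup E] [InnerProductSpace ℂ E]
    [FiniteDimensional ℂ E] (Θ : MTTO.T → E →L[ℂ] E) (hΘ : MTTO.IsInner Θ)
    (hpure : MTTO.IsPure Θ) (A : MTTO.modelSpace Θ →L[ℂ] MTTO.modelSpace Θ) :
    A ∈ MTTO.truncatedToeplitz Θ ↔ MTTO.IsShiftInvariant A :=
  ⟨fun ⟨_, _, hA⟩ => hΘ.isShiftInvariant_of_symbol hA, hΘ.exists_symbol⟩
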